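/- For a finite undirected $d$-regular multigraph $\Gamma$ (loops and multiple edges allowed) with at least two vertices, let $M$ be its averaging operator, $(Mv)(x)=\frac1d\sum_{y\sim x}v(y)$ (sum with multiplicities), let $\lambda_1\ge\lambda_2\ge\cdots$ be the eigenvalues of $M$ listed with multiplicity, and put $\mathrm{gap}(\Gamma)=1-\lambda_2$. A finite multiset $S$ of elements of a group $G$ is symmetric if each element appears with the same multiplicity as its inverse; $|S|$ is its size counted with multiplicity. If $G$ acts on a finite set $\Omega$, the Schreier graph $\mathrm{Sch}(G\circlearrowleft\Omega,S)$ is the $|S|$-regular multigraph with vertex set $\Omega$ in which every $s\in S$ (with multiplicity) gives an edge from $\omega$ to its image under $s$, for every $\omega\in\Omega$. Theorem. Let $G$ be a (possibly infinite) nilpotent group of class $c\ge 1$ acting transitively on a finite set $\Omega$ with $|\Omega|\ge 2$. Then for every finite symmetric multiset $S$ of elements of $G$ with $|S|\ge 2$, $$\mathrm{gap}(\mathrm{Sch}(G\circlearrowleft\Omega,S))\le 5\,|\Omega|^{-f(|S|,c)},$$ where $$f(|S|,c)=\frac{2(|S|-1)}{|S|\,(|S|^{c+1}-|S|^2+|S|-1)}\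 \ge\ |S|^{-c-1}.$$ -/

import Mathlib

/-- A multiset of group elements is symmetric if each element appears with the same multiplicity
as its inverse. -/
def SymmetricMultiset {G : Type*} [Group G] (S : Multiset G) : Prop :=
  open Classical in ∀ g : G, S.count g⁻¹ = S.count g

/-- An undirected `d`-regular multigraph on the finite vertex set `V` (loops and multiple edges are
allowed), given by its edge multiplicities: `mult x y` is the number of edges from `x` to `y`. -/
structure RegularMultigraph (V : Type*) [Fintype V] (d : ℕ) where
  mult : V → V → ℕ
  symm : ∀ x y, mult x y = mult y x
  regular : ∀ x, ∑ y, mult x y = d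

namespace RegularMultigraph

variable {V : Type*} [Fintype V] {d : ℕ}

/-- The averaging operator `(M v)(x) = (1/d) ∑_{y ~ x} v(y)`, the sum taken with multiplicities,
as a real matrix. -/
noncomputable def averaging (Γ : RegularMultigraph V d) : Matrix V V ℝ :=
  Matrix.of fun x y => (Γ.mult x y : ℝ) / d

theorem averaging_mulVec (Γ : RegularMultigraph V d) (v : V → ℝ) (x : V) :
    (Γ.averaging.mulVec v) x = (1 / d : ℝ) * ∑ y, (Γ.mult x y : ℝ) * v y := by
  simp only [averaging, Matrix.mulVec, dotProduct, Matrix.of_apply, Finset.mul_sum]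
  exact Finset.sum_congr rfl fun y _ => by ring

theorem averaging_isHermitian (Γ : RegularMultigraph V d) : Γ.averaging.IsHermitian := by
  ext x y
  simp [averaging, Γ.symm y x]

/-- The second largest eigenvalue `λ₂` of the averaging operator, where the eigenvalues are listed
with multiplicity in decreasing order `λ₁ ≥ λ₂ ≥ …` (`eigenvalues₀` is that list, indexed from
`0`). There have to be at least two vertices. -/
noncomputable def lambdaTwo [DecidableEq V] [Nontrivial V] (Γ : RegularMultigraph V d) : ℝ :=
  Γ.averaging_isHermitian.eigenvalues₀ ⟨1, Fintype.one_lt_card⟩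

/-- The spectral gap `1 - λ₂`. -/
noncomputable def gap [DecidableEq V] [Nontrivial V] (Γ : RegularMultigraph V d) : ℝ :=
  1 - Γ.lambdaTwo

end RegularMultigraph

theorem SymmetricMultiset.map_inv {G : Type*} [Group G] {S : Multiset G}
    (hS : SymmetricMultiset S) : S.map (fun g => g⁻¹) = S := by
  classical
  ext g
  have h := Multiset.count_map_eq_count' (fun g : G => g⁻¹) S inv_injective g⁻¹
  simp only [inv_inv] at h
  rw [h]
  convert hS g

theorem sum_countP_smul {G : Type*} [Group G] {Ω : Type*} [Fintype Ω] [DecidableEq Ω]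
    [MulAction G Ω] (S : Multiset G) (x : Ω) :
    ∑ y, S.countP (fun s => s • x = y) = Multiset.card S := by
  induction S using Multiset.induction_on with
  | empty => simp
  | cons a S ih => simp [Multiset.countP_cons, Finset.sum_add_distrib, ih]

/-- The Schreier graph of the action of `G` on `Ω` with respect to a symmetric multiset `S`:
the vertices are the points of `Ω`, and each `s` in `S` (counted with multiplicity) contributes
one edge from `ω` to `s • ω`, for every `ω`. -/
noncomputable def schreierGraph {G : Type*} [Group G] (Ω : Type*) [Fintype Ω] [DecidableEq Ω]
    [MulAction G Ω] (S : Multiset G) (hS : SymmetricMultiset S) :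
    RegularMultigraph Ω (Multiset.card S) where
  mult x y := S.countP fun s => s • x = y
  symm x y := by
    conv_lhs => rw [← hS.map_inv]
    rw [Multiset.countP_map, Multiset.countP_eq_card_filter]
    congr 1
    refine Multiset.filter_congr fun s _ => ?_
    rw [inv_smul_eq_iff, eq_comm]
  regular x := by
    exact sum_countP_smul S x

/-- The exponent `f(d, c) = 2(d-1) / (d (d^{c+1} - d² + d - 1))`. -/
noncomputable def nilpotentGapExponent (d c : ℕ) : ℝ :=
  2 * ((d : ℝ) - 1) / ((d : ℝ) * ((d : ℝ) ^ (c + 1) - (d : ℝ) ^ 2 + (d : ℝ) - 1))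

/-! Put `d = |S|`, `N = |Ω|` and `T = N ^ f`; the claim is gap `≤ 5 / T`. A mean-zero function that
the generators barely move forces the gap to be small. If the group `K` generated by `S` is not
transitive, a two-valued function on an orbit and its complement shows that the gap is at most `0`.
Otherwise let `H` be a point stabilizer in `K`. A nontrivial character of `K / H[K,K]` gives a
unimodular mean-zero function on `Ω` that each generator multiplies by a scalar, so it suffices to
find such a character close to `1` on the generators. With `A = |K / H[K,K]|` and `T > 4`, the
pigeonhole principle provides one as soon as `T ^ d ≤ A ^ 2` (`exists_monoidHom_ne_one_re_ge`).

Nilpotency bounds `N` by a power of `A` (`Subgroup.index_le_index_sup_commutator_pow`). The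
commutator pairs each graded piece of the lower central series with the abelianization, and its
values generate the next piece. Hence the index of the image of `H` in every piece is controlled by
`A` and the number of generators. Multiplying the indices gives `N ≤ A ^ E` with `E = 1 + d² + ⋯ + d
^ c`, and `f = 2 / (d E)` is the exponent for which `T ^ d = N ^ (2 / E) ≤ A ^ 2`.

For `T ≤ 4` the difference of the point masses at two vertices joined by few edges is already a good
enough test function. -/

/-! ### Variational bounds for the second eigenvalue. -/

open Matrix in
/-- The quadratic form of a real symmetric matrix on the orthogonal complement of a top eigenvector
is bounded by the second largest eigenvalue. -/
theorem Matrix.IsHermitian.exists_quadraticForm_le_eigenvalues₀_one {V : Type*} [Fintype V]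
    [DecidableEq V] {A : Matrix V V ℝ} (hA : A.IsHermitian) (hV : 1 < Fintype.card V) :
    ∃ e : V → ℝ, ∀ w : V → ℝ, e ⬝ᵥ w = 0 →
      w ⬝ᵥ A *ᵥ w ≤ hA.eigenvalues₀ ⟨1, hV⟩ * (w ⬝ᵥ w) := by
  let b := hA.eigenvectorBasis
  -- The same equivalence that defines `eigenvalues` from `eigenvalues₀`, so index `0` is carried to
  -- a top eigenvector.
  let σ : Fin (Fintype.card V) ≃ V := Fintype.equivOfCardEq (Fintype.card_fin _)
  have hinner : ∀ x y : V → ℝ, inner ℝ (WithLp.toLp 2 x) (WithLp.toLp 2 y) = x ⬝ᵥ y := by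
    intro x y
    rw [EuclideanSpace.inner_toLp_toLp]
    simp [dotProduct_comm]
  have hpars : ∀ x y : V → ℝ, x ⬝ᵥ y = ∑ i, ((b i : V → ℝ) ⬝ᵥ x) * ((b i : V → ℝ) ⬝ᵥ y) := by
    intro x y
    rw [← hinner, ← b.sum_inner_mul_inner]
    refine Finset.sum_congr rfl fun i _ => ?_
    rw [real_inner_comm]
    exact congrArg₂ (· * ·) (hinner (b i) x) (hinner (b i) y)
  have heig : ∀ (i : V) (w : V → ℝ),
      (b i : V → ℝ) ⬝ᵥ A *ᵥ w = hA.eigenvalues i * ((b i : V → ℝ) ⬝ᵥ w) := by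
    intro i w
    have hT : Aᵀ = A := (show A.IsSymm by simpa using hA)
    rw [dotProduct_mulVec, ← mulVec_transpose, hT, hA.mulVec_eigenvectorBasis, smul_dotProduct,
      smul_eq_mul]
  refine ⟨b (σ ⟨0, by omega⟩), fun w hw => ?_⟩
  rw [hpars w (A *ᵥ w), hpars w w, Finset.mul_sum]
  refine Finset.sum_le_sum fun i _ => ?_
  rw [heig]
  by_cases hi : i = σ ⟨0, by omega⟩
  · rw [hi, hw]; simp
  · have hle : hA.eigenvalues i ≤ hA.eigenvalues₀ ⟨1, hV⟩ := by
      refine hA.eigenvalues₀_antitone ?_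
      have h0 : σ.symm i ≠ ⟨0, by omega⟩ := fun h => hi (by rw [← h, Equiv.apply_symm_apply])
      rw [Fin.le_def]
      by_contra hlt
      exact h0 (Fin.ext (by simp only at hlt ⊢; exact Nat.lt_one_iff.mp (not_le.mp hlt)))
    nlinarith [mul_self_nonneg ((b i : V → ℝ) ⬝ᵥ w)]

namespace RegularMultigraph

open Matrix

variable {V : Type*} [Fintype V] {d : ℕ}

theorem averaging_mulVec_one (Γ : RegularMultigraph V d) (hd : d ≠ 0) :
    Γ.averaging *ᵥ (fun _ => 1) = fun _ => 1 := by
  ext x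
  have h : (∑ y, (Γ.mult x y : ℝ)) = d := by exact_mod_cast Γ.regular x
  rw [averaging_mulVec]
  simp [h, hd]

theorem quadraticForm_averaging (Γ : RegularMultigraph V d) (u : V → ℝ) :
    u ⬝ᵥ Γ.averaging *ᵥ u = ∑ x, ∑ y, (Γ.mult x y : ℝ) / d * (u x * u y) := by
  simp only [dotProduct, Matrix.mulVec, averaging, of_apply, Finset.mul_sum]
  exact Finset.sum_congr rfl fun x _ => Finset.sum_congr rfl fun y _ => by ring

theorem quadraticForm_averaging_le (Γ : RegularMultigraph V d) (hd : d ≠ 0) (u : V → ℝ) :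
    u ⬝ᵥ Γ.averaging *ᵥ u ≤ u ⬝ᵥ u := by
  have hrow : ∀ x, ∑ y, (Γ.mult x y : ℝ) / d = 1 := by
    intro x
    have h : (∑ y, (Γ.mult x y : ℝ)) = d := by exact_mod_cast Γ.regular x
    rw [← Finset.sum_div, h, div_self (by exact_mod_cast hd)]
  have h1 : ∑ x, ∑ y, (Γ.mult x y : ℝ) / d * (u x * u x) = u ⬝ᵥ u := by
    simp only [← Finset.sum_mul, hrow, one_mul, dotProduct]
  have h2 : ∑ x, ∑ y, (Γ.mult x y : ℝ) / d * (u y * u y) = u ⬝ᵥ u := by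
    rw [Finset.sum_comm, ← h1]
    refine Finset.sum_congr rfl fun x _ => Finset.sum_congr rfl fun y _ => ?_
    rw [Γ.symm y x]
  have h3 : 2 * ∑ x, ∑ y, (Γ.mult x y : ℝ) / d * (u x * u y) ≤
      ∑ x, ∑ y, (Γ.mult x y : ℝ) / d * (u x * u x) +
        ∑ x, ∑ y, (Γ.mult x y : ℝ) / d * (u y * u y) := by
    rw [Finset.mul_sum, ← Finset.sum_add_distrib]
    refine Finset.sum_le_sum fun x _ => ?_
    rw [Finset.mul_sum, ← Finset.sum_add_distrib]
    refine Finset.sum_le_sum fun y _ => ?_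
    have : (0 : ℝ) ≤ (Γ.mult x y : ℝ) / d := by positivity
    nlinarith [mul_nonneg this (sq_nonneg (u x - u y))]
  rw [quadraticForm_averaging]
  linarith

variable [DecidableEq V] [Nontrivial V]

/-- The variational bound for the second eigenvalue. -/
theorem quadraticForm_le_lambdaTwo (Γ : RegularMultigraph V d) (hd : d ≠ 0) (u : V → ℝ)
    (hu : ∑ x, u x = 0) : u ⬝ᵥ Γ.averaging *ᵥ u ≤ Γ.lambdaTwo * (u ⬝ᵥ u) := by
  obtain ⟨e, he⟩ := Γ.averaging_isHermitian.exists_quadraticForm_le_eigenvalues₀_one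
    (Fintype.one_lt_card (α := V))
  change ∀ w, _ → _ ≤ Γ.lambdaTwo * _ at he
  have huu : 0 ≤ u ⬝ᵥ u := Finset.sum_nonneg fun x _ => mul_self_nonneg _
  -- The top eigenvector `e` need not be constant. If `λ₂ ≥ 1`, the bound `M ≤ 1` suffices;
  -- otherwise some combination of `1` and `u` orthogonal to `e` is tested.
  rcases le_or_gt 1 Γ.lambdaTwo with h1 | h1
  · nlinarith [Γ.quadraticForm_averaging_le hd u]
  set o : V → ℝ := fun _ => 1 with ho
  have hMo : Γ.averaging *ᵥ o = o := Γ.averaging_mulVec_one hd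
  have hoo : 0 < o ⬝ᵥ o := by simp [ho, dotProduct, Fintype.card_pos]
  have hou : o ⬝ᵥ u = 0 := by simpa [ho, dotProduct] using hu
  have huo : u ⬝ᵥ o = 0 := by rw [dotProduct_comm, hou]
  have hoMu : o ⬝ᵥ Γ.averaging *ᵥ u = 0 := by
    have hT : Γ.averagingᵀ = Γ.averaging :=
      (show Γ.averaging.IsSymm by simpa using Γ.averaging_isHermitian)
    rw [dotProduct_mulVec, ← mulVec_transpose, hT, hMo, hou]
  have key : ∀ a b : ℝ, a * (e ⬝ᵥ o) + b * (e ⬝ᵥ u) = 0 →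
      a ^ 2 * (o ⬝ᵥ o) + b ^ 2 * (u ⬝ᵥ Γ.averaging *ᵥ u) ≤
        Γ.lambdaTwo * (a ^ 2 * (o ⬝ᵥ o) + b ^ 2 * (u ⬝ᵥ u)) := by
    intro a b hab
    have h := he (a • o + b • u) (by
      simpa only [dotProduct_add, dotProduct_smul, smul_eq_mul] using hab)
    simp only [mulVec_add, mulVec_smul, dotProduct_add, add_dotProduct, dotProduct_smul,
      smul_dotProduct, smul_eq_mul, hMo, hou, huo, hoMu] at h
    nlinarith [h]
  -- Were `e` orthogonal to the constants, the vector `1` itself would give `1 ≤ λ₂`.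
  have heo : e ⬝ᵥ o ≠ 0 := by
    intro h0
    have h := key 1 0 (by simp [h0])
    nlinarith
  have h := key (e ⬝ᵥ u) (-(e ⬝ᵥ o)) (by ring)
  have hpos : 0 < (-(e ⬝ᵥ o)) ^ 2 := by
    have := neg_ne_zero.mpr heo
    positivity
  have h2 : (-(e ⬝ᵥ o)) ^ 2 * (u ⬝ᵥ Γ.averaging *ᵥ u - Γ.lambdaTwo * (u ⬝ᵥ u)) ≤ 0 := by
    have : 0 ≤ (e ⬝ᵥ u) ^ 2 * (o ⬝ᵥ o) * (1 - Γ.lambdaTwo) := by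
      have := sub_pos.mpr h1
      positivity
    nlinarith
  by_contra hcon
  have := mul_pos hpos (sub_pos.mpr (not_le.mp hcon))
  linarith

theorem gap_le_of_quadraticForm (Γ : RegularMultigraph V d) (hd : d ≠ 0) (u : V → ℝ)
    (hu : ∑ x, u x = 0) (hpos : 0 < u ⬝ᵥ u) (ε : ℝ)
    (h : (1 - ε) * (u ⬝ᵥ u) ≤ u ⬝ᵥ Γ.averaging *ᵥ u) : Γ.gap ≤ ε := by
  have := h.trans (Γ.quadraticForm_le_lambdaTwo hd u hu)
  have := le_of_mul_le_mul_right this hpos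
  unfold gap
  linarith

/-- The test vector `δ_x - δ_y` has squared norm `2`, and its quadratic form is at least `-2 m / d`,
where `m` is the multiplicity between `x` and `y`: loops only help. -/
theorem gap_le_one_add_mult_div (Γ : RegularMultigraph V d) (hd : d ≠ 0) {x y : V} (hxy : x ≠ y) :
    Γ.gap ≤ 1 + (Γ.mult x y : ℝ) / d := by
  have hdot : ∀ w : V → ℝ, (Pi.single x 1 - Pi.single y 1) ⬝ᵥ w = w x - w y := by
    intro w
    simp [sub_dotProduct]
  refine Γ.gap_le_of_quadraticForm hd (Pi.single x 1 - Pi.single y 1) ?_ ?_ _ ?_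
  · simp
  · rw [hdot]; simp [hxy, hxy.symm]
  · rw [hdot, hdot]
    simp only [mulVec_sub, mulVec_single_one, Pi.sub_apply, averaging, col_apply, of_apply,
      Γ.symm y x, Pi.single_eq_same, Pi.single_eq_of_ne hxy, Pi.single_eq_of_ne hxy.symm]
    have h1 : (0 : ℝ) ≤ (Γ.mult x x : ℝ) / d := by positivity
    have h2 : (0 : ℝ) ≤ (Γ.mult y y : ℝ) / d := by positivity
    linarith

theorem exists_ne_card_sub_one_mul_mult_le (Γ : RegularMultigraph V d) :
    ∃ x y : V, x ≠ y ∧ (Fintype.card V - 1) * Γ.mult x y ≤ d := by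
  classical
  obtain ⟨x, z, hxz⟩ := exists_pair_ne V
  obtain ⟨y, hy, hmin⟩ := Finset.exists_min_image (Finset.univ.erase x) (Γ.mult x)
    ⟨z, by simp [hxz.symm]⟩
  refine ⟨x, y, fun h => by simp [h] at hy, ?_⟩
  calc (Fintype.card V - 1) * Γ.mult x y
      = ∑ w ∈ Finset.univ.erase x, Γ.mult x y := by simp [Finset.card_erase_of_mem]
    _ ≤ ∑ w ∈ Finset.univ.erase x, Γ.mult x w := Finset.sum_le_sum hmin
    _ ≤ ∑ w, Γ.mult x w := Finset.sum_le_sum_of_subset (Finset.erase_subset _ _)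
    _ = d := Γ.regular x

end RegularMultigraph

/-! ### Test functions on Schreier graphs. -/

section Schreier

open Matrix

variable {G : Type*} [Group G] {Ω : Type*} [Fintype Ω] [DecidableEq Ω] [MulAction G Ω]

theorem schreierGraph_averaging_mulVec (S : Multiset G) (hS : SymmetricMultiset S) (u : Ω → ℝ)
    (x : Ω) : ((schreierGraph Ω S hS).averaging *ᵥ u) x =
      (1 / Multiset.card S : ℝ) * (S.map fun s => u (s • x)).sum := by
  rw [RegularMultigraph.averaging_mulVec]
  congr 1
  change ∑ y, ((S.countP fun s => s • x = y : ℕ) : ℝ) * u y = _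
  induction S using Multiset.induction_on with
  | empty => simp
  | cons a S ih =>
    have ih' : ∑ y, ((S.countP fun s => s • x = y : ℕ) : ℝ) * u y =
        (S.map fun s => u (s • x)).sum := by
      clear ih hS
      induction S using Multiset.induction_on with
      | empty => simp
      | cons a S ih => simp [Multiset.countP_cons, add_mul, Finset.sum_add_distrib, ih, add_comm]
    simp [Multiset.countP_cons, add_mul, Finset.sum_add_distrib, ih', add_comm]

variable [Nontrivial Ω]

/-- If the generated subgroup is not transitive, the Schreier graph has no spectral gap. -/
theorem schreierGraph_gap_nonpos (S : Multiset G) (hS : SymmetricMultiset S)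
    (hcard : Multiset.card S ≠ 0) (O : Finset Ω) (hO : O.Nonempty) (hO' : Oᶜ.Nonempty)
    (hinv : ∀ s ∈ S, ∀ x, s • x ∈ O ↔ x ∈ O) : (schreierGraph Ω S hS).gap ≤ 0 := by
  set u : Ω → ℝ := fun x => if x ∈ O then (Oᶜ.card : ℝ) else -(O.card : ℝ) with hu
  have hM : (schreierGraph Ω S hS).averaging *ᵥ u = u := by
    ext x
    rw [schreierGraph_averaging_mulVec]
    have : S.map (fun s => u (s • x)) = S.map (fun _ => u x) :=
      Multiset.map_congr rfl fun s hs => by simp only [hu, hinv s hs x]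
    rw [this]
    simp only [Multiset.map_const', Multiset.sum_replicate, nsmul_eq_mul]
    field_simp
  have hpos : 0 < u ⬝ᵥ u := by
    have h1 : 0 < O.card := hO.card_pos
    have h2 : 0 < Oᶜ.card := hO'.card_pos
    obtain ⟨x, hx⟩ := hO
    refine Finset.sum_pos' (fun x _ => mul_self_nonneg _) ⟨x, Finset.mem_univ _, ?_⟩
    simp only [hu, hx, if_true]
    positivity
  refine RegularMultigraph.gap_le_of_quadraticForm _ hcard u ?_ hpos 0 ?_
  · have : ∀ x, u x = (if x ∈ O then (Oᶜ.card : ℝ) else 0) + if x ∈ Oᶜ then -(O.card : ℝ) else 0 := by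
      intro x
      by_cases hx : x ∈ O <;> simp [hu, hx]
    simp only [this, Finset.sum_add_distrib, Finset.sum_ite_mem, Finset.univ_inter,
      Finset.sum_const, nsmul_eq_mul]
    ring
  · rw [hM]; linarith

/-- A unimodular function which is an approximate eigenfunction for each generator bounds the
spectral gap. -/
theorem schreierGraph_gap_le_of_eigenfunction (S : Multiset G) (hS : SymmetricMultiset S)
    (hcard : Multiset.card S ≠ 0) (ψ : Ω → ℂ) (hψ : ∀ x, Complex.normSq (ψ x) = 1)
    (hsum : ∑ x, ψ x = 0) (ε : ℝ)
    (h : ∀ s ∈ S, ∃ z : ℂ, 1 - ε ≤ z.re ∧ ∀ x, ψ (s • x) = z * ψ x) :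
    (schreierGraph Ω S hS).gap ≤ ε := by
  set Γ := schreierGraph Ω S hS
  set a : Ω → ℝ := fun x => (ψ x).re
  set b : Ω → ℝ := fun x => (ψ x).im
  have ha : ∑ x, a x = 0 := by simpa using congrArg Complex.re hsum
  have hb : ∑ x, b x = 0 := by simpa using congrArg Complex.im hsum
  have hab : a ⬝ᵥ a + b ⬝ᵥ b = Fintype.card Ω := by
    simp only [dotProduct, ← Finset.sum_add_distrib]
    have : ∀ x, a x * a x + b x * b x = 1 := fun x => by
      rw [← hψ x, Complex.normSq_apply]
    simp [this]
  -- The right side is the real part of `conj (ψ x) * (M ψ) x`, an average of the numbers `z.re`.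
  -- Adding the Rayleigh bounds for real and imaginary parts avoids asking which of them is nonzero.
  have hpt : ∀ x, 1 - ε ≤ a x * (Γ.averaging *ᵥ a) x + b x * (Γ.averaging *ᵥ b) x := by
    intro x
    have hle : Multiset.card S * (1 - ε) ≤
        (S.map fun s => a x * a (s • x) + b x * b (s • x)).sum := by
      have := Multiset.card_nsmul_le_sum (s := S.map fun s => a x * a (s • x) + b x * b (s • x))
        (a := 1 - ε) (by
          intro r hr
          obtain ⟨s, hs, rfl⟩ := Multiset.mem_map.mp hr
          obtain ⟨z, hz, hzx⟩ := h s hs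
          have h1 : (ψ x).re * (ψ x).re + (ψ x).im * (ψ x).im = 1 := by
            rw [← hψ x, Complex.normSq_apply]
          have : a x * a (s • x) + b x * b (s • x) = z.re := by
            simp only [a, b, hzx, Complex.mul_re, Complex.mul_im]
            linear_combination z.re * h1
          rwa [this])
      simpa using this
    rw [schreierGraph_averaging_mulVec, schreierGraph_averaging_mulVec]
    rw [Multiset.sum_map_add, Multiset.sum_map_mul_left, Multiset.sum_map_mul_left] at hle
    have hc : (0 : ℝ) < Multiset.card S := by positivity
    have : a x * (1 / (Multiset.card S : ℝ) * (S.map fun s => a (s • x)).sum) +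
        b x * (1 / (Multiset.card S : ℝ) * (S.map fun s => b (s • x)).sum) =
        (a x * (S.map fun s => a (s • x)).sum + b x * (S.map fun s => b (s • x)).sum) /
          Multiset.card S := by
      field_simp
    rw [this, le_div_iff₀ hc]
    linarith
  have hge : (1 - ε) * Fintype.card Ω ≤ a ⬝ᵥ Γ.averaging *ᵥ a + b ⬝ᵥ Γ.averaging *ᵥ b := by
    simp only [dotProduct, ← Finset.sum_add_distrib]
    have := Finset.sum_le_sum fun x (_ : x ∈ Finset.univ) => hpt x
    simp only [Finset.sum_const, Finset.card_univ, nsmul_eq_mul] at this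
    linarith
  have h1 := Γ.quadraticForm_le_lambdaTwo hcard a ha
  have h2 := Γ.quadraticForm_le_lambdaTwo hcard b hb
  have hN : (0 : ℝ) < Fintype.card Ω := by exact_mod_cast Fintype.card_pos
  have : (1 - ε) * Fintype.card Ω ≤ Γ.lambdaTwo * Fintype.card Ω := by
    rw [← hab] at hge ⊢
    nlinarith
  have := le_of_mul_le_mul_right this hN
  unfold RegularMultigraph.gap
  linarith

end Schreier

/-! ### Generators and indices under bilinear pairings of commutative groups. -/

/-- A subgroup of a commutative group with `m` generators has at most `m` generators. -/
theorem Subgroup.exists_closure_range_eq_of_commGroup {P : Type*} [CommGroup P] {m : ℕ}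
    (p : Fin m → P) (hp : Subgroup.closure (Set.range p) = ⊤) (R : Subgroup P) :
    ∃ (n : ℕ) (ρ : Fin n → P), n ≤ m ∧ Subgroup.closure (Set.range ρ) = R := by
  let E : (Fin m → ℤ) →+ Additive P :=
    { toFun := fun c => Additive.ofMul (∏ i, p i ^ c i)
      map_zero' := by simp
      map_add' := fun c c' => by simp [zpow_add, Finset.prod_mul_distrib] }
  -- The preimage of `R` in `ℤ ^ m` is free of rank at most `m`; a basis maps to generators of `R`.
  let N : Submodule ℤ (Fin m → ℤ) := AddSubgroup.toIntSubmodule ((Subgroup.toAddSubgroup R).comap E)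
  have hN : ∀ c, c ∈ N ↔ (E c).toMul ∈ R := fun c => Iff.rfl
  obtain ⟨n, b⟩ := Submodule.basisOfPid (Pi.basisFun ℤ (Fin m)) N
  refine ⟨n, fun k => (E (b k : Fin m → ℤ)).toMul, ?_, le_antisymm ?_ ?_⟩
  · have h1 := Submodule.finrank_le N
    rw [Module.finrank_eq_card_basis b] at h1
    simpa using h1
  · rw [Subgroup.closure_le]
    rintro _ ⟨k, rfl⟩
    exact (hN _).mp (b k).2
  · intro x hx
    obtain ⟨c, hc⟩ := (Subgroup.mem_closure_range_iff_of_fintype (f := p) (x := x)).mp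
      (by rw [hp]; trivial)
    have hcN : c ∈ N := (hN c).mpr (by simpa [E, hc] using hx)
    have hsum := b.sum_repr ⟨c, hcN⟩
    have hE : E c = ∑ k, b.repr ⟨c, hcN⟩ k • E (b k : Fin m → ℤ) := by
      have := congrArg (fun z : N => E (z : Fin m → ℤ)) hsum
      simp only [Submodule.coe_sum, Submodule.coe_smul, map_sum, map_zsmul] at this
      exact this.symm
    rw [Subgroup.mem_closure_range_iff_of_fintype]
    refine ⟨fun k => b.repr ⟨c, hcN⟩ k, ?_⟩
    have := congrArg Additive.toMul hE
    simpa [E, hc] using this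

section Pairing

variable {P V Q : Type*} [CommGroup P] [CommGroup V] [CommGroup Q]

theorem MonoidHom.apply_mem_range_prod_of_closure (β : P →* V →* Q) {κ : Type*} [Fintype κ]
    (v : κ → V) (x : P) {y : V} (hy : y ∈ Subgroup.closure (Set.range v)) :
    ∃ a : κ → P, (∀ j, a j ∈ Subgroup.zpowers x) ∧ β x y = ∏ j, β (a j) (v j) := by
  obtain ⟨c, rfl⟩ := Subgroup.mem_closure_range_iff_of_fintype.mp hy
  refine ⟨fun j => x ^ c j, fun j => ⟨c j, rfl⟩, ?_⟩
  simp

/-- Bilinearity merges all factors with the same second argument `v j`, so one factor per generator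
suffices, whatever the length of a word for `q`. This makes the count in
`MonoidHom.index_le_of_pairing` finite. -/
theorem MonoidHom.exists_eq_prod_of_closure_pairing (β : P →* V →* Q) {κ : Type*} [Fintype κ]
    (v : κ → V) (hv : Subgroup.closure (Set.range v) = ⊤)
    (hβ : Subgroup.closure {q | ∃ x y, β x y = q} = ⊤) (q : Q) :
    ∃ a : κ → P, q = ∏ j, β (a j) (v j) := by
  have hq : q ∈ Subgroup.closure {q | ∃ x y, β x y = q} := by rw [hβ]; trivial
  induction hq using Subgroup.closure_induction with
  | mem q hq =>
    obtain ⟨x, y, rfl⟩ := hq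
    obtain ⟨a, -, ha⟩ := β.apply_mem_range_prod_of_closure v x (y := y) (by rw [hv]; trivial)
    exact ⟨a, ha⟩
  | one => exact ⟨1, by simp⟩
  | mul q q' _ _ h h' =>
    obtain ⟨a, rfl⟩ := h
    obtain ⟨a', rfl⟩ := h'
    exact ⟨a * a', by simp [Finset.prod_mul_distrib]⟩
  | inv q _ h =>
    obtain ⟨a, rfl⟩ := h
    exact ⟨a⁻¹, by simp⟩

theorem MonoidHom.exists_eq_prod_of_mem_closure_left (β : P →* V →* Q) {κ : Type*} [Fintype κ]
    (p : κ → P) {x : P} (hx : x ∈ Subgroup.closure (Set.range p)) (y : V) :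
    ∃ a : κ → V, β x y = ∏ j, β (p j) (a j) := by
  obtain ⟨a, -, ha⟩ := β.flip.apply_mem_range_prod_of_closure p y hx
  exact ⟨a, ha⟩

/-- A spanning pairing multiplies numbers of generators. -/
theorem MonoidHom.closure_range_pairing (β : P →* V →* Q) {ι κ : Type*} [Fintype ι] [Fintype κ]
    (p : ι → P) (hp : Subgroup.closure (Set.range p) = ⊤)
    (v : κ → V) (hv : Subgroup.closure (Set.range v) = ⊤)
    (hβ : Subgroup.closure {q | ∃ x y, β x y = q} = ⊤) :
    Subgroup.closure (Set.range fun i : ι × κ => β (p i.1) (v i.2)) = ⊤ := by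
  rw [eq_top_iff]
  intro q _
  obtain ⟨a, rfl⟩ := β.exists_eq_prod_of_closure_pairing v hv hβ q
  refine Subgroup.prod_mem _ fun j _ => ?_
  have ha : a j ∈ Subgroup.closure (Set.range p) := by rw [hp]; trivial
  obtain ⟨c, hc⟩ := Subgroup.mem_closure_range_iff_of_fintype.mp ha
  rw [hc]
  simp only [map_prod, map_zpow, MonoidHom.finsetProd_apply]
  refine Subgroup.prod_mem _ fun i _ => ?_
  exact Subgroup.zpow_mem _ (Subgroup.subset_closure (Set.mem_range_self (i, j))) _

/-- The index bound for a spanning pairing. -/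
theorem MonoidHom.index_le_of_pairing (β : P →* V →* Q) {m r : ℕ}
    (p : Fin m → P) (hp : Subgroup.closure (Set.range p) = ⊤)
    (v : Fin r → V) (hv : Subgroup.closure (Set.range v) = ⊤)
    (hβ : Subgroup.closure {q | ∃ x y, β x y = q} = ⊤)
    (R : Subgroup P) (W : Subgroup V) (R' : Subgroup Q)
    (hR : R.index ≠ 0) (hW : W.index ≠ 0) (hR' : ∀ x ∈ R, ∀ y ∈ W, β x y ∈ R') :
    R'.index ≠ 0 ∧ R'.index ≤ R.index ^ r * W.index ^ m := by
  obtain ⟨n, ρ, hnm, hρ⟩ := Subgroup.exists_closure_range_eq_of_commGroup p hp R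
  have hρR : ∀ k, ρ k ∈ R := fun k => hρ ▸ Subgroup.subset_closure ⟨k, rfl⟩
  have : R.FiniteIndex := ⟨hR⟩
  have : W.FiniteIndex := ⟨hW⟩
  -- Write `q = ∏ β (a j) (v j)` and split `a j` into a coset representative and an element of `R`.
  -- The `R`-parts regroup as `∏ β (ρ k) (y k)`, where `y k` matters only modulo `W` because `β`
  -- sends `R × W` into `R'`.
  let F : (Fin r → P ⧸ R) × (Fin n → V ⧸ W) → Q ⧸ R' := fun ab =>
    (((∏ j, β (ab.1 j).out (v j)) * ∏ k, β (ρ k) (ab.2 k).out : Q) : Q ⧸ R')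
  have hF : Function.Surjective F := by
    intro q
    obtain ⟨q, rfl⟩ := QuotientGroup.mk_surjective q
    obtain ⟨a, rfl⟩ := β.exists_eq_prod_of_closure_pairing v hv hβ q
    have h1 : ∀ j, ∃ c : Fin n → V, β ((QuotientGroup.mk (a j) : P ⧸ R).out⁻¹ * a j) (v j) =
        ∏ k, β (ρ k) (c k) := by
      intro j
      refine β.exists_eq_prod_of_mem_closure_left ρ ?_ (v j)
      rw [hρ, ← QuotientGroup.eq, QuotientGroup.out_eq']
    choose c hc using h1
    let y : Fin n → V := fun k => ∏ j, c j k
    refine ⟨(fun j => QuotientGroup.mk (a j), fun k => QuotientGroup.mk (y k)), ?_⟩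
    refine QuotientGroup.eq.mpr ?_
    have h2 : ∏ j, β (a j) (v j) = (∏ j, β (QuotientGroup.mk (a j) : P ⧸ R).out (v j)) *
        ∏ k, β (ρ k) (y k) := by
      have : ∏ k, β (ρ k) (y k) = ∏ j, ∏ k, β (ρ k) (c j k) := by
        rw [Finset.prod_comm]
        simp [y]
      rw [this, ← Finset.prod_mul_distrib]
      refine Finset.prod_congr rfl fun j _ => ?_
      rw [← hc j, ← MonoidHom.mul_apply, ← map_mul, mul_inv_cancel_left]
    rw [h2, mul_inv, mul_mul_mul_comm, inv_mul_cancel, one_mul, ← Finset.prod_inv_distrib,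
      ← Finset.prod_mul_distrib]
    refine Subgroup.prod_mem _ fun k _ => ?_
    rw [← map_inv, ← map_mul]
    refine hR' _ (hρR k) _ ?_
    rw [← QuotientGroup.eq, QuotientGroup.out_eq']
  have hfin : Finite (Q ⧸ R') := Finite.of_surjective F hF
  refine ⟨Subgroup.FiniteIndex.index_ne_zero (self := Subgroup.finiteIndex_of_finite_quotient), ?_⟩
  calc R'.index ≤ Nat.card ((Fin r → P ⧸ R) × (Fin n → V ⧸ W)) := Nat.card_le_card_of_surjective F hF
    _ = R.index ^ r * W.index ^ n := by simp [Subgroup.index, Nat.card_prod, Nat.card_fun]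
    _ ≤ _ := by gcongr; omega

theorem index_le_two_pow_of_closure_range {Q : Type*} [CommGroup Q] {m : ℕ} (p : Fin m → Q)
    (hp : Subgroup.closure (Set.range p) = ⊤) (h2 : ∀ x : Q, x ^ 2 = 1) (R : Subgroup Q) :
    R.index ≤ 2 ^ m := by
  let F : (Fin m → Bool) → Q := fun b => ∏ i, if b i then p i else 1
  have hF : Function.Surjective F := by
    intro q
    obtain ⟨c, rfl⟩ := (Subgroup.mem_closure_range_iff_of_fintype (f := p) (x := q)).mp
      (by rw [hp]; trivial)
    refine ⟨fun i => decide (c i % 2 = 1), Finset.prod_congr rfl fun i _ => ?_⟩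
    have : p i ^ c i = p i ^ (c i % 2) := by
      conv_lhs => rw [← Int.mul_ediv_add_emod (c i) 2, zpow_add, zpow_mul]
      have := h2 (p i)
      norm_cast
      simp [this]
    rcases Int.emod_two_eq_zero_or_one (c i) with h | h <;> simp [this, h]
  have : Finite Q := Finite.of_surjective F hF
  calc R.index ≤ Nat.card Q := Nat.le_of_dvd Nat.card_pos R.index_dvd_card
    _ ≤ Nat.card (Fin m → Bool) := Nat.card_le_card_of_surjective F hF
    _ = 2 ^ m := by simp

end Pairing

/-! ### The commutator pairing on the lower central series. -/

section Graded

open scoped commutatorElement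

variable (G : Type*) [Group G]

/-- The `n`-th successive quotient of the lower central series. -/
abbrev LowerCentralQuotient (n : ℕ) : Type _ :=
  (⊤ : Subgroup G).lowerCentralSeries n ⧸
    ((⊤ : Subgroup G).lowerCentralSeries (n + 1)).subgroupOf ((⊤ : Subgroup G).lowerCentralSeries n)

variable {G}

theorem commutatorElement_mem_lowerCentralSeries_succ {n : ℕ} {x : G}
    (hx : x ∈ (⊤ : Subgroup G).lowerCentralSeries n) (g : G) :
    ⁅x, g⁆ ∈ (⊤ : Subgroup G).lowerCentralSeries (n + 1) :=
  Subgroup.commutator_mem_commutator hx (Subgroup.mem_top g)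

namespace LowerCentralQuotient

/-- The class of an element of the lower central series. -/
def mk {n : ℕ} (x : G) (hx : x ∈ (⊤ : Subgroup G).lowerCentralSeries n) :
    LowerCentralQuotient G n :=
  QuotientGroup.mk ⟨x, hx⟩

theorem mk_eq_mk_iff {n : ℕ} {x y : G} (hx : x ∈ (⊤ : Subgroup G).lowerCentralSeries n)
    (hy : y ∈ (⊤ : Subgroup G).lowerCentralSeries n) :
    mk x hx = mk y hy ↔ x⁻¹ * y ∈ (⊤ : Subgroup G).lowerCentralSeries (n + 1) := by
  unfold mk
  rw [QuotientGroup.eq, Subgroup.mem_subgroupOf]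
  rfl

theorem mk_mul_mk {n : ℕ} {x y : G} (hx : x ∈ (⊤ : Subgroup G).lowerCentralSeries n)
    (hy : y ∈ (⊤ : Subgroup G).lowerCentralSeries n) :
    mk x hx * mk y hy = mk (x * y) (mul_mem hx hy) := rfl

theorem exists_mk_eq {n : ℕ} (q : LowerCentralQuotient G n) : ∃ x hx, mk x hx = q := by
  obtain ⟨⟨x, hx⟩, rfl⟩ := QuotientGroup.mk_surjective q
  exact ⟨x, hx, rfl⟩

instance commGroup (n : ℕ) : CommGroup (LowerCentralQuotient G n) where
  mul_comm := by
    intro a b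
    obtain ⟨x, hx, rfl⟩ := exists_mk_eq a
    obtain ⟨y, hy, rfl⟩ := exists_mk_eq b
    rw [mk_mul_mk, mk_mul_mk, mk_eq_mk_iff]
    have : (x * y)⁻¹ * (y * x) = ⁅y⁻¹, x⁻¹⁆ := by
      rw [commutatorElement_def]; group
    rw [this]
    exact commutatorElement_mem_lowerCentralSeries_succ (inv_mem hy) _

/-- The commutator as a homomorphism in the second variable. -/
def commutatorHomRight {n : ℕ} (x : G) (hx : x ∈ (⊤ : Subgroup G).lowerCentralSeries n) :
    G →* LowerCentralQuotient G (n + 1) :=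
  MonoidHom.mk' (fun g => mk ⁅x, g⁆ (commutatorElement_mem_lowerCentralSeries_succ hx g)) <| by
    intro g h
    have hxh := commutatorElement_mem_lowerCentralSeries_succ hx h
    rw [mk_mul_mk, mk_eq_mk_iff]
    have : ⁅x, g * h⁆⁻¹ * (⁅x, g⁆ * ⁅x, h⁆) = ⁅⁅x, h⁆⁻¹, g⁆⁻¹ := by
      simp only [commutatorElement_def]; group
    rw [this]
    exact inv_mem (commutatorElement_mem_lowerCentralSeries_succ (inv_mem hxh) _)

theorem commutatorHomRight_mul {n : ℕ} {x y : G} (hx : x ∈ (⊤ : Subgroup G).lowerCentralSeries n)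
    (hy : y ∈ (⊤ : Subgroup G).lowerCentralSeries n) :
    commutatorHomRight (x * y) (mul_mem hx hy) =
      commutatorHomRight x hx * commutatorHomRight y hy := by
  ext g
  change mk _ _ = mk _ _ * mk _ _
  have hyg := commutatorElement_mem_lowerCentralSeries_succ hy g
  have hxg := commutatorElement_mem_lowerCentralSeries_succ hx g
  rw [mul_comm, mk_mul_mk, eq_comm, mk_eq_mk_iff]
  have : (⁅y, g⁆ * ⁅x, g⁆)⁻¹ * ⁅x * y, g⁆ =
      ⁅x, g⁆⁻¹ * ⁅⁅y, g⁆⁻¹, x⁆ * ⁅x, g⁆⁻¹⁻¹ := by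
    simp only [commutatorElement_def]; group
  rw [this]
  exact (inferInstance : ((⊤ : Subgroup G).lowerCentralSeries (n + 1 + 1)).Normal).conj_mem _
    (commutatorElement_mem_lowerCentralSeries_succ (inv_mem hyg) x) _

/-- The commutator pairing of the graded pieces of the lower central series. -/
noncomputable def pairing (n : ℕ) :
    LowerCentralQuotient G n →* Abelianization G →* LowerCentralQuotient G (n + 1) :=
  let φ : LowerCentralQuotient G n →* G →* LowerCentralQuotient G (n + 1) :=
    QuotientGroup.lift _
      (MonoidHom.mk' (fun x : (⊤ : Subgroup G).lowerCentralSeries n => commutatorHomRight x.1 x.2)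
        fun x y => commutatorHomRight_mul x.2 y.2) <| by
      intro x hx
      ext g
      change mk _ _ = mk 1 (one_mem _)
      rw [eq_comm, mk_eq_mk_iff]
      rw [inv_one, one_mul]
      exact commutatorElement_mem_lowerCentralSeries_succ (Subgroup.mem_subgroupOf.mp hx) g
  (Abelianization.lift φ.flip).flip

theorem pairing_mk_of {n : ℕ} {x : G} (hx : x ∈ (⊤ : Subgroup G).lowerCentralSeries n) (g : G) :
    pairing n (mk x hx) (Abelianization.of g) =
      mk ⁅x, g⁆ (commutatorElement_mem_lowerCentralSeries_succ hx g) := rfl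

theorem closure_pairing (n : ℕ) :
    Subgroup.closure {q | ∃ (x : LowerCentralQuotient G n) (y : Abelianization G),
      pairing n x y = q} = ⊤ := by
  rw [eq_top_iff]
  intro q _
  obtain ⟨z, hz, rfl⟩ := exists_mk_eq q
  have key : ∀ z (hz : z ∈ Subgroup.closure {x | ∃ p ∈ (⊤ : Subgroup G).lowerCentralSeries n,
      ∃ q ∈ (⊤ : Subgroup G), ⁅p, q⁆ = x}), mk (n := n + 1) z hz ∈
        Subgroup.closure {q | ∃ (x : LowerCentralQuotient G n) (y : Abelianization G),
      pairing n x y = q} := by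
    intro z hz
    induction hz using Subgroup.closure_induction with
    | mem z h =>
      obtain ⟨x, hx, g, -, rfl⟩ := h
      exact Subgroup.subset_closure ⟨mk x hx, Abelianization.of g, pairing_mk_of hx g⟩
    | one => exact one_mem _
    | mul x y hx hy h h' => exact mul_mem h h'
    | inv x hx h => exact inv_mem h
  exact key z hz

/-- The image of a subgroup in a graded piece of the lower central series. -/
def image (H : Subgroup G) (n : ℕ) : Subgroup (LowerCentralQuotient G n) :=
  (H.subgroupOf ((⊤ : Subgroup G).lowerCentralSeries n)).map (QuotientGroup.mk' _)

theorem mk_mem_image {H : Subgroup G} {n : ℕ} {x : G}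
    (hx : x ∈ (⊤ : Subgroup G).lowerCentralSeries n) (hxH : x ∈ H) : mk x hx ∈ image H n :=
  ⟨⟨x, hx⟩, hxH, rfl⟩

theorem pairing_mem_image (H : Subgroup G) (n : ℕ) (a : LowerCentralQuotient G n)
    (ha : a ∈ image H n) (b : Abelianization G) (hb : b ∈ H.map Abelianization.of) :
    pairing n a b ∈ image H (n + 1) := by
  obtain ⟨⟨x, hx⟩, hxH, rfl⟩ := ha
  obtain ⟨h, hh, rfl⟩ := hb
  have hxH' : x ∈ H := hxH
  refine mk_mem_image (commutatorElement_mem_lowerCentralSeries_succ hx h) ?_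
  rw [commutatorElement_def]
  exact mul_mem (mul_mem (mul_mem hxH' hh) (inv_mem hxH')) (inv_mem hh)

theorem index_image (H : Subgroup G) (n : ℕ) :
    (image H n).index = (H.subgroupOf ((⊤ : Subgroup G).lowerCentralSeries n) ⊔
      ((⊤ : Subgroup G).lowerCentralSeries (n + 1)).subgroupOf
        ((⊤ : Subgroup G).lowerCentralSeries n)).index := by
  rw [image, Subgroup.index_map, QuotientGroup.ker_mk',
    MonoidHom.range_eq_top_of_surjective _ (QuotientGroup.mk'_surjective _), Subgroup.index_top,
    mul_one]

/-- Write `Γ`, `Γ'` for the consecutive terms. Elements of `Γ` represent all cosets of `H Γ'` in `H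
Γ`, and multiplying on the right by `(H ∩ Γ) Γ'` does not change the coset. -/
theorem relIndex_le_index_image (H : Subgroup G) (n : ℕ) (h0 : (image H n).index ≠ 0) :
    (H ⊔ (⊤ : Subgroup G).lowerCentralSeries (n + 1)).relIndex
      (H ⊔ (⊤ : Subgroup G).lowerCentralSeries n) ≤ (image H n).index := by
  set Γ := (⊤ : Subgroup G).lowerCentralSeries n
  set Γ' := (⊤ : Subgroup G).lowerCentralSeries (n + 1)
  rw [index_image] at h0 ⊢
  set L := H.subgroupOf Γ ⊔ Γ'.subgroupOf Γ
  have : L.FiniteIndex := ⟨h0⟩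
  have hL : ∀ x : Γ, x ∈ L → (x : G) ∈ H ⊔ Γ' := by
    have : L ≤ (H ⊔ Γ').subgroupOf Γ :=
      sup_le (fun x hx => Subgroup.mem_sup_left (S := H) (T := Γ') hx)
        (fun x hx => Subgroup.mem_sup_right (S := H) (T := Γ') hx)
    exact fun x hx => this hx
  let K : Subgroup (H ⊔ Γ : Subgroup G) := (H ⊔ Γ').subgroupOf (H ⊔ Γ)
  let F : Γ ⧸ L → (H ⊔ Γ : Subgroup G) ⧸ K :=
    Quotient.lift (fun x : Γ => QuotientGroup.mk
      (⟨x, Subgroup.mem_sup_right (S := H) x.2⟩ : (H ⊔ Γ : Subgroup G))) (by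
        intro x y hxy
        refine QuotientGroup.eq.mpr (Subgroup.mem_subgroupOf.mpr ?_)
        exact hL _ (QuotientGroup.leftRel_apply.mp hxy))
  refine Nat.card_le_card_of_surjective F ?_
  intro q
  obtain ⟨⟨q, hq⟩, rfl⟩ := QuotientGroup.mk_surjective q
  -- The factor from `H` must stand on the right to be absorbed by a left coset; normality of `Γ`
  -- permits this order.
  obtain ⟨x, hx, h, hh, rfl⟩ := Subgroup.mem_sup_of_normal_left.mp
    (show q ∈ Γ ⊔ H by rwa [sup_comm])
  refine ⟨QuotientGroup.mk ⟨x, hx⟩, ?_⟩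
  refine QuotientGroup.eq.mpr (Subgroup.mem_subgroupOf.mpr ?_)
  change x⁻¹ * (x * h) ∈ _
  rw [inv_mul_cancel_left]
  exact Subgroup.mem_sup_left hh

end LowerCentralQuotient

end Graded

/-! ### Index of a subgroup in terms of its image in the abelianization. -/

namespace LowerCentralQuotient

variable {G : Type*} [Group G]

/-- The projection of a group to the first graded piece of its lower central series. -/
def proj (G : Type*) [Group G] : G →* LowerCentralQuotient G 0 :=
  MonoidHom.mk' (fun g => mk g (Subgroup.mem_top g : g ∈ (⊤ : Subgroup G).lowerCentralSeries 0)) fun _ _ => rfl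

theorem proj_surjective : Function.Surjective (proj G) := fun q => by
  obtain ⟨x, _, rfl⟩ := exists_mk_eq q
  exact ⟨x, rfl⟩

theorem ker_proj : (proj G).ker = (⊤ : Subgroup G).lowerCentralSeries 1 := by
  ext x
  have hx : x ∈ (⊤ : Subgroup G).lowerCentralSeries 0 := Subgroup.mem_top x
  rw [MonoidHom.mem_ker]
  change mk x hx = mk 1 (one_mem _) ↔ _
  rw [eq_comm, mk_eq_mk_iff, inv_one, one_mul]

theorem closure_range_comp_eq_top {K L ι : Type*} [Group K] [Group L] (f : K →* L)
    (hf : Function.Surjective f) (s : ι → K) (hs : Subgroup.closure (Set.range s) = ⊤) :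
    Subgroup.closure (Set.range fun i => f (s i)) = ⊤ := by
  have : (Set.range fun i => f (s i)) = f '' Set.range s := Set.range_comp f s
  rw [this, ← MonoidHom.map_closure, hs, ← MonoidHom.range_eq_map]
  exact MonoidHom.range_eq_top_of_surjective f hf

/-- Pairing with the abelianization multiplies the number of generators by `r`. The series is
indexed from `0`, so piece `0` is the abelianization, with `r` generators. -/
theorem exists_generators {r : ℕ} (s : Fin r → G) (hs : Subgroup.closure (Set.range s) = ⊤)
    (n : ℕ) : ∃ p : Fin (r ^ (n + 1)) → LowerCentralQuotient G n,
      Subgroup.closure (Set.range p) = ⊤ := by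
  induction n with
  | zero =>
    let e : Fin (r ^ (0 + 1)) ≃ Fin r := finCongr (by simp)
    refine ⟨(fun i => proj G (s i)) ∘ e, ?_⟩
    rw [e.surjective.range_comp]
    exact closure_range_comp_eq_top (proj G) proj_surjective s hs
  | succ n ih =>
    obtain ⟨p, hp⟩ := ih
    have h := (pairing (G := G) n).closure_range_pairing p hp (fun i => Abelianization.of (s i))
      (closure_range_comp_eq_top _ QuotientGroup.mk_surjective s hs) (closure_pairing n)
    let e : Fin (r ^ (n + 1 + 1)) ≃ Fin (r ^ (n + 1)) × Fin r :=
      (finCongr (pow_succ r (n + 1))).trans finProdFinEquiv.symm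
    refine ⟨(fun i => pairing n (p i.1) (Abelianization.of (s i.2))) ∘ e, ?_⟩
    rw [e.surjective.range_comp]
    exact h

theorem image_zero_eq_map (H : Subgroup G) : image H 0 = H.map (proj G) := by
  ext q
  constructor
  · rintro ⟨⟨x, hx⟩, hxH, rfl⟩
    exact ⟨x, hxH, rfl⟩
  · rintro ⟨x, hxH, rfl⟩
    exact mk_mem_image _ hxH

theorem index_image_zero (H : Subgroup G) :
    (image H 0).index = (H ⊔ (⊤ : Subgroup G).lowerCentralSeries 1).index := by
  rw [image_zero_eq_map, Subgroup.index_map, ker_proj,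
    MonoidHom.range_eq_top_of_surjective _ proj_surjective, Subgroup.index_top, mul_one]

theorem index_map_abelianization (H : Subgroup G) :
    (H.map Abelianization.of).index = (H ⊔ (⊤ : Subgroup G).lowerCentralSeries 1).index := by
  rw [Subgroup.index_map, Abelianization.ker_of,
    MonoidHom.range_eq_top_of_surjective _ QuotientGroup.mk_surjective, Subgroup.index_top, mul_one]
  rfl

/-- Piece `n` has `r ^ (n + 1)` generators, so `MonoidHom.index_le_of_pairing` gives exponents with
`e (n + 1) = r * e n + r ^ (n + 1)` and `e 0 = 1`, solved by `(n + 1) * r ^ n`. -/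
theorem index_image_le {r : ℕ} (s : Fin r → G) (hs : Subgroup.closure (Set.range s) = ⊤)
    (H : Subgroup G) (hH : H.index ≠ 0) (n : ℕ) :
    (image H n).index ≠ 0 ∧ (image H n).index ≤
      (H ⊔ (⊤ : Subgroup G).lowerCentralSeries 1).index ^ ((n + 1) * r ^ n) := by
  have hA : (H ⊔ (⊤ : Subgroup G).lowerCentralSeries 1).index ≠ 0 := fun h =>
    hH (Nat.eq_zero_of_zero_dvd (h ▸ Subgroup.index_dvd_of_le le_sup_left))
  induction n with
  | zero =>
    rw [index_image_zero]
    exact ⟨hA, by simp⟩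
  | succ n ih =>
    obtain ⟨p, hp⟩ := exists_generators s hs n
    have h := (pairing (G := G) n).index_le_of_pairing p hp (fun i => Abelianization.of (s i))
      (closure_range_comp_eq_top _ QuotientGroup.mk_surjective s hs) (closure_pairing n)
      (image H n) (H.map Abelianization.of) (image H (n + 1)) ih.1
      (by rwa [index_map_abelianization]) (pairing_mem_image H n)
    refine ⟨h.1, h.2.trans ?_⟩
    rw [index_map_abelianization]
    calc _ ≤ ((H ⊔ (⊤ : Subgroup G).lowerCentralSeries 1).index ^ ((n + 1) * r ^ n)) ^ r *
          (H ⊔ (⊤ : Subgroup G).lowerCentralSeries 1).index ^ r ^ (n + 1) := by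
            gcongr; exact ih.2
      _ = _ := by rw [← pow_mul, ← pow_add]; congr 1; ring

theorem sq_eq_one_of_closure {Q : Type*} [CommGroup Q] {T : Set Q}
    (hT : Subgroup.closure T = ⊤) (h : ∀ x ∈ T, x ^ 2 = 1) (x : Q) : x ^ 2 = 1 := by
  have : Subgroup.closure T ≤ (powMonoidHom 2 : Q →* Q).ker :=
    (Subgroup.closure_le _).mpr fun x hx => h x hx
  exact this (by rw [hT]; trivial : x ∈ Subgroup.closure T)

/-- Exponent `2` passes from the abelianization to every piece by bilinearity of the commutator
pairing. -/
theorem sq_eq_one {r : ℕ} (s : Fin r → G) (hs : Subgroup.closure (Set.range s) = ⊤)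
    (hs2 : ∀ i, s i ^ 2 = 1) (n : ℕ) (x : LowerCentralQuotient G n) : x ^ 2 = 1 := by
  have hgen : ∀ {Q : Type _} [CommGroup Q] (f : G →* Q), Function.Surjective f →
      ∀ x : Q, x ^ 2 = 1 := by
    intro Q _ f hf
    refine sq_eq_one_of_closure (closure_range_comp_eq_top f hf s hs) ?_
    rintro _ ⟨i, rfl⟩
    rw [← map_pow, hs2, map_one]
  induction n with
  | zero => exact hgen (proj G) proj_surjective x
  | succ n ih =>
    refine sq_eq_one_of_closure (closure_pairing n) ?_ x
    rintro _ ⟨a, b, rfl⟩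
    rw [← MonoidHom.pow_apply, ← map_pow, ih, map_one, MonoidHom.one_apply]

theorem index_sup_lowerCentralSeries_le (H : Subgroup G) (h0 : ∀ n, (image H n).index ≠ 0) (n : ℕ) :
    (H ⊔ (⊤ : Subgroup G).lowerCentralSeries n).index ≤
      ∏ k ∈ Finset.range n, (image H k).index := by
  induction n with
  | zero => simp
  | succ n ih =>
    have hle : H ⊔ (⊤ : Subgroup G).lowerCentralSeries (n + 1) ≤
        H ⊔ (⊤ : Subgroup G).lowerCentralSeries n :=
      sup_le_sup_left (Subgroup.lowerCentralSeries_antitone _ (Nat.le_succ n)) H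
    rw [← Subgroup.relIndex_mul_index hle, Finset.prod_range_succ, mul_comm]
    exact Nat.mul_le_mul ih (relIndex_le_index_image H n (h0 n))

end LowerCentralQuotient

open LowerCentralQuotient in
/-- In a nilpotent group with few generators, the index of a subgroup is bounded polynomially in
terms of the index of its image in the abelianization. -/
theorem Subgroup.index_le_index_sup_commutator_pow {G : Type*} [Group G] {r d c : ℕ} (hc : 1 ≤ c)
    (hG : (⊤ : Subgroup G).lowerCentralSeries c = ⊥) (s : Fin r → G)
    (hs : Subgroup.closure (Set.range s) = ⊤)
    (hrd : r + 1 ≤ d ∨ (r ≤ d ∧ ∀ i, s i ^ 2 = 1)) (H : Subgroup G) (hH : 2 ≤ H.index) :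
    H.index ≤ (H ⊔ (⊤ : Subgroup G).lowerCentralSeries 1).index ^
      (1 + ∑ n ∈ Finset.Ico 1 c, d ^ (n + 1)) := by
  set A := (H ⊔ (⊤ : Subgroup G).lowerCentralSeries 1).index with hA
  have himg := index_image_le s hs H (by omega)
  have hprod : H.index ≤ ∏ k ∈ Finset.range c, (image H k).index := by
    have := index_sup_lowerCentralSeries_le H (fun n => (himg n).1) c
    rwa [hG, sup_bot_eq] at this
  -- A proper subgroup of a nilpotent group has proper image in the abelianization: `A = 1` would
  -- force every graded index to be `1`.
  have hA2 : 2 ≤ A := by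
    by_contra hlt
    have hA0 : A ≠ 0 := by rw [hA, ← index_image_zero]; exact (himg 0).1
    have hA1 : A = 1 := by omega
    have hA1 : ∀ k ∈ Finset.range c, (image H k).index ≤ 1 := fun k _ =>
      (himg k).2.trans (by rw [← hA, hA1, one_pow])
    have := hprod.trans (Finset.prod_le_one' hA1)
    omega
  have hbound : ∀ n, (image H n).index ≤ A ^ d ^ (n + 1) := by
    intro n
    rcases hrd with hrd | ⟨hrd, hs2⟩
    · refine (himg n).2.trans (Nat.pow_le_pow_right (by omega) ?_)
      -- The left side is one term of the binomial expansion.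
      calc (n + 1) * r ^ n ≤ (r + 1) ^ (n + 1) := by
            rw [add_pow]
            refine le_trans ?_ (Finset.single_le_sum (fun _ _ => Nat.zero_le _)
              (show n ∈ Finset.range (n + 1 + 1) by simp))
            simp [mul_comm]
        _ ≤ d ^ (n + 1) := Nat.pow_le_pow_left hrd _
    -- With `r = d` allowed, the previous estimate fails; instead the piece is an elementary abelian
    -- `2`-group of order at most `2 ^ r ^ (n + 1)`, and `2 ≤ A`.
    · obtain ⟨p, hp⟩ := exists_generators s hs n
      calc (image H n).index ≤ 2 ^ r ^ (n + 1) :=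
            index_le_two_pow_of_closure_range p hp (sq_eq_one s hs hs2 n) _
        _ ≤ 2 ^ d ^ (n + 1) := Nat.pow_le_pow_right (by omega) (Nat.pow_le_pow_left hrd _)
        _ ≤ _ := Nat.pow_le_pow_left hA2 _
  calc H.index ≤ ∏ k ∈ Finset.range c, (image H k).index := hprod
    _ = (image H 0).index * ∏ k ∈ Finset.Ico 1 c, (image H k).index := by
      rw [Finset.range_eq_Ico, Finset.prod_eq_prod_Ico_succ_bot (by omega)]
    _ ≤ A * ∏ k ∈ Finset.Ico 1 c, A ^ d ^ (k + 1) := by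
      rw [index_image_zero]
      exact Nat.mul_le_mul le_rfl (Finset.prod_le_prod' fun k _ => hbound k)
    _ = _ := by rw [Finset.prod_pow_eq_pow_sum, pow_add, pow_one]

/-! ### Characters of finite commutative groups close to `1` on generators. -/

section Characters

/-- The numerical inequality behind the pigeonhole principle for characters. -/
theorem card_pow_mul_two_pow_lt {A p q ℓ : ℕ} (hA : 0 < A) (hpq : 0 < p + q) {T : ℝ} (hT : 4 < T)
    (hTA : T ^ (2 * p + q) ≤ (A : ℝ) ^ 2) (hℓ : A / (2 * √T) ≤ ℓ) :
    A ^ p * 2 ^ q < A * ℓ ^ p := by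
  have hA' : (0 : ℝ) < A := by exact_mod_cast hA
  have hT0 : 0 < T := by linarith
  have hsq : (A : ℝ) ^ 2 / (4 * T) ≤ (ℓ : ℝ) ^ 2 := by
    have := pow_le_pow_left₀ (by positivity) hℓ 2
    rwa [div_pow, mul_pow, Real.sq_sqrt hT0.le, show (2 : ℝ) ^ 2 = 4 by norm_num] at this
  have hgt : (1 : ℝ) < (T / 4) ^ (p + q) := one_lt_pow₀ (by linarith) (by omega)
  -- A `t j` costs a factor at most `2√T < T` and a `u j` costs `2 < √T`; together they stay below
  -- `T ^ (p + q / 2) ≤ A`. Squaring removes the roots.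
  have key : ((A : ℝ) ^ p * 2 ^ q) ^ 2 < ((A : ℝ) * ℓ ^ p) ^ 2 := by
    calc ((A : ℝ) ^ p * 2 ^ q) ^ 2 = (A : ℝ) ^ (2 * p) * 4 ^ q * 1 := by
          rw [mul_pow, ← pow_mul, ← pow_mul, mul_comm q 2, pow_mul 2 2 q]; ring_nf
      _ < (A : ℝ) ^ (2 * p) * 4 ^ q * (T / 4) ^ (p + q) := by gcongr
      _ = T ^ (2 * p + q) * ((A : ℝ) ^ 2 / (4 * T)) ^ p := by
          rw [div_pow, div_pow, mul_pow, pow_add 4 p q, pow_mul, pow_add T (2 * p), pow_add T p,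
            two_mul, pow_add T p p]
          field_simp
      _ ≤ (A : ℝ) ^ 2 * ((ℓ : ℝ) ^ 2) ^ p := by gcongr
      _ = ((A : ℝ) * ℓ ^ p) ^ 2 := by ring
  have := lt_of_pow_lt_pow_left₀ 2 (by positivity) key
  exact_mod_cast this

/-- Since `|b - a| ≤ A / (2√T)`, the angle is at most `π / √T`. The constant `5` comes from `cos θ ≥
1 - θ² / 2` and `π² ≤ 10`. -/
theorem one_sub_five_div_le_cos {A ℓ : ℕ} (hA : 0 < A) {T : ℝ} (hT : 0 < T)
    (hℓ : (ℓ : ℝ) < A / (2 * √T) + 1) {a b : ℕ} (ha : a < ℓ) (hb : b < ℓ) :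
    1 - 5 / T ≤ Real.cos (2 * Real.pi * ((b : ℝ) - a) / A) := by
  have hA' : (0 : ℝ) < A := by exact_mod_cast hA
  have ha' : (a : ℝ) + 1 ≤ ℓ := by exact_mod_cast ha
  have hb' : (b : ℝ) + 1 ≤ ℓ := by exact_mod_cast hb
  have ha0 : (0 : ℝ) ≤ a := a.cast_nonneg
  have hb0 : (0 : ℝ) ≤ b := b.cast_nonneg
  have hsT : 0 < √T := Real.sqrt_pos.mpr hT
  have habs : |(b : ℝ) - a| ≤ A / (2 * √T) := by
    rw [abs_le]; constructor <;> linarith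
  have hsq : ((b : ℝ) - a) ^ 2 ≤ (A : ℝ) ^ 2 / (4 * T) := by
    have := pow_le_pow_left₀ (abs_nonneg _) habs 2
    rwa [sq_abs, div_pow, mul_pow, Real.sq_sqrt hT.le, show (2 : ℝ) ^ 2 = 4 by norm_num] at this
  have hpi : Real.pi ^ 2 ≤ 10 := by
    have := Real.pi_lt_d2
    nlinarith [Real.pi_pos]
  refine le_trans ?_ Real.one_sub_sq_div_two_le_cos
  have : (2 * Real.pi * ((b : ℝ) - a) / A) ^ 2 / 2 ≤ 5 / T := by
    calc (2 * Real.pi * ((b : ℝ) - a) / A) ^ 2 / 2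
        = 2 * Real.pi ^ 2 * ((b : ℝ) - a) ^ 2 / (A : ℝ) ^ 2 := by ring
      _ ≤ 2 * 10 * ((A : ℝ) ^ 2 / (4 * T)) / (A : ℝ) ^ 2 := by gcongr
      _ = 5 / T := by field_simp; norm_num
  linarith

/-- A finite commutative group with few generators has a nontrivial character which is nearly
trivial on the generators. -/
theorem exists_monoidHom_ne_one_re_ge {B : Type*} [CommGroup B] [Finite B] {p q : ℕ}
    (t : Fin p → B) (u : Fin q → B) (hu : ∀ j, u j ^ 2 = 1) (hpq : 0 < p + q) {T : ℝ} (hT : 4 < T)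
    (hTB : T ^ (2 * p + q) ≤ (Nat.card B : ℝ) ^ 2) :
    ∃ χ : B →* ℂˣ, χ ≠ 1 ∧ (∀ j, χ (u j) = 1) ∧ ∀ j, 1 - 5 / T ≤ ((χ (t j) : ℂˣ) : ℂ).re := by
  set A := Nat.card B with hAdef
  have hA : 0 < A := Nat.card_pos
  have : NeZero A := ⟨hA.ne'⟩
  have hexp : NeZero (Monoid.exponent B) := ⟨Monoid.exponent_ne_zero_of_finite⟩
  have hcard : Nat.card (B →* ℂˣ) = A := CommGroup.card_monoidHom_of_hasEnoughRootsOfUnity B ℂ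
  have : Finite (B →* ℂˣ) := Nat.finite_of_card_ne_zero (by omega)
  have hT0 : 0 < T := by linarith
  set ℓ := ⌈(A : ℝ) / (2 * √T)⌉₊ with hℓ
  have hℓ1 : (A : ℝ) / (2 * √T) ≤ ℓ := Nat.le_ceil _
  have hℓ2 : (ℓ : ℝ) < A / (2 * √T) + 1 := Nat.ceil_lt_add_one (by positivity)
  have hℓA : ℓ ≤ A := by
    rw [hℓ, Nat.ceil_le]
    have : 1 ≤ √T := Real.one_le_sqrt.mpr (by linarith)
    exact div_le_self (by positivity) (by linarith)
  have hprim := Complex.isPrimitiveRoot_exp A hA.ne'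
  set ζ : ℂˣ := (hprim.isUnit hA.ne').unit with hζ
  have hζprim : IsPrimitiveRoot ζ A := by
    rw [← IsPrimitiveRoot.coe_units_iff]; exact hprim
  have hζval : ∀ n : ℕ, ((ζ ^ n : ℂˣ) : ℂ) = Complex.exp (((2 * Real.pi * n / A : ℝ) : ℂ) * Complex.I) := by
    intro n
    rw [Units.val_pow_eq_pow_val]
    change Complex.exp _ ^ n = _
    rw [← Complex.exp_nat_mul]
    congr 1
    push_cast
    ring
  -- Pigeonhole on characters with their values at the `t j` rotated by fewer than `ℓ` steps: `A * ℓ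
  -- ^ p` pairs against `A ^ p * 2 ^ q` targets. A collision means that two characters differ by a
  -- short rotation at each `t j` and agree at each `u j`.
  let F : (B →* ℂˣ) × (Fin p → Fin ℓ) → (Fin p → rootsOfUnity A ℂ) × (Fin q → rootsOfUnity 2 ℂ) :=
    fun x => (fun j => ⟨x.1 (t j) * ζ ^ (x.2 j : ℕ), by
        rw [mem_rootsOfUnity, mul_pow, ← map_pow, ← pow_mul, mul_comm (x.2 j : ℕ), pow_mul,
          hζprim.pow_eq_one, pow_card_eq_one', map_one, one_pow, one_mul]⟩,
      fun j => ⟨x.1 (u j), by rw [mem_rootsOfUnity, ← map_pow, hu, map_one]⟩)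
  have hnotinj : ¬ Function.Injective F := by
    intro hinj
    have hle := Nat.card_le_card_of_injective F hinj
    have hlt := card_pow_mul_two_pow_lt hA hpq hT hTB hℓ1
    have hr : ∀ n : ℕ, [NeZero n] → Nat.card (rootsOfUnity n ℂ) = n := fun n _ =>
      HasEnoughRootsOfUnity.natCard_rootsOfUnity ℂ n
    rw [Nat.card_prod, Nat.card_prod, Nat.card_fun, Nat.card_fun, Nat.card_fun, hcard, hr A, hr 2,
      Nat.card_fin, Nat.card_fin, Nat.card_fin] at hle
    omega
  obtain ⟨⟨χ₁, τ₁⟩, ⟨χ₂, τ₂⟩, hF, hne⟩ : ∃ x y, F x = F y ∧ x ≠ y := by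
    simpa [Function.Injective] using hnotinj
  have h1 : ∀ j, χ₁ (t j) * ζ ^ (τ₁ j : ℕ) = χ₂ (t j) * ζ ^ (τ₂ j : ℕ) := fun j =>
    congrArg Subtype.val (congrFun (congrArg Prod.fst hF) j)
  have h2 : ∀ j, χ₁ (u j) = χ₂ (u j) := fun j =>
    congrArg Subtype.val (congrFun (congrArg Prod.snd hF) j)
  refine ⟨χ₁ / χ₂, ?_, ?_, ?_⟩
  -- Equal characters would force equal rotations, because `ℓ ≤ A` and `ζ` has order `A`.
  · intro h
    have hχ : χ₁ = χ₂ := div_eq_one.mp h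
    refine hne (Prod.ext hχ (funext fun j => Fin.ext ?_))
    have h3 := h1 j
    rw [hχ] at h3
    exact hζprim.pow_inj ((τ₁ j).2.trans_le hℓA) ((τ₂ j).2.trans_le hℓA) (mul_left_cancel h3)
  · intro j
    rw [MonoidHom.div_apply, h2, div_self']
  · intro j
    have h3 : (χ₁ / χ₂) (t j) * ζ ^ (τ₁ j : ℕ) = ζ ^ (τ₂ j : ℕ) := by
      rw [MonoidHom.div_apply, div_mul_eq_mul_div, h1, mul_div_cancel_left]
    have h4 : (((χ₁ / χ₂) (t j) : ℂˣ) : ℂ) =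
        Complex.exp (((2 * Real.pi * ((τ₂ j : ℕ) - (τ₁ j : ℕ) : ℝ) / A : ℝ) : ℂ) * Complex.I) := by
      rw [eq_div_of_mul_eq' h3, Units.val_div_eq_div_val, hζval,
        hζval, ← Complex.exp_sub]
      congr 1
      push_cast
      ring
    rw [h4, Complex.exp_ofReal_mul_I_re]
    exact one_sub_five_div_le_cos hA hT0 hℓ2 (τ₁ j).2 (τ₂ j).2

end Characters

/-! ### From characters to functions on `Ω`. -/

section TransitiveAction

variable {K Ω : Type*} [Group K] [MulAction K Ω] [MulAction.IsPretransitive K Ω]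

/-- A homomorphism which is trivial on a point stabilizer yields an equivariant function. -/
theorem MonoidHom.exists_equivariant (φ : K →* ℂˣ) (ω : Ω)
    (h : ∀ g ∈ MulAction.stabilizer K ω, φ g = 1) :
    ∃ ψ : Ω → ℂˣ, ∀ g x, ψ (g • x) = φ g * ψ x := by
  choose γ hγ using fun x : Ω => MulAction.exists_smul_eq K ω x
  refine ⟨fun x => φ (γ x), fun g x => ?_⟩
  have : (γ (g • x))⁻¹ * (g * γ x) ∈ MulAction.stabilizer K ω := by
    rw [MulAction.mem_stabilizer_iff, mul_smul, mul_smul, hγ, inv_smul_eq_iff, hγ]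
  have h1 := h _ this
  rw [map_mul, map_inv, inv_mul_eq_one] at h1
  beta_reduce
  rw [h1, map_mul]

/-- A transitive action of a group with few generators has a nearly invariant eigenfunction, if the
image of a point stabilizer in the abelianization has large index. -/
theorem exists_almost_invariant_eigenfunction [Fintype Ω] (ω : Ω) {p q : ℕ}
    (t : Fin p → K) (u : Fin q → K) (hu : ∀ j, u j ^ 2 = 1) (hpq : 0 < p + q) {T : ℝ} (hT : 4 < T)
    (hTA : T ^ (2 * p + q) ≤ ((MulAction.stabilizer K ω ⊔
      (⊤ : Subgroup K).lowerCentralSeries 1).index : ℝ) ^ 2) :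
    ∃ ψ : Ω → ℂ, (∀ x, Complex.normSq (ψ x) = 1) ∧ ∑ x, ψ x = 0 ∧
      (∀ j x, ψ (u j • x) = ψ x) ∧
      ∀ j, ∃ z : ℂ, 1 - 5 / T ≤ z.re ∧ z ≠ 0 ∧ z⁻¹.re = z.re ∧ ∀ x, ψ (t j • x) = z * ψ x := by
  set H := MulAction.stabilizer K ω
  have hH : H.index ≠ 0 := by
    rw [MulAction.index_stabilizer_of_transitive, Nat.card_eq_fintype_card]
    exact (Fintype.card_pos_iff.mpr ⟨ω⟩).ne'
  let W := H.map (Abelianization.of (G := K))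
  have hW : W.index = (H ⊔ (⊤ : Subgroup K).lowerCentralSeries 1).index :=
    LowerCentralQuotient.index_map_abelianization H
  have hW0 : W.index ≠ 0 := by
    rw [hW]
    exact fun h => hH (Nat.eq_zero_of_zero_dvd (h ▸ Subgroup.index_dvd_of_le le_sup_left))
  have : W.FiniteIndex := ⟨hW0⟩
  let π : K →* Abelianization K ⧸ W := (QuotientGroup.mk' W).comp Abelianization.of
  have hπ : Function.Surjective π :=
    (QuotientGroup.mk'_surjective W).comp QuotientGroup.mk_surjective
  obtain ⟨χ, hχ, hχu, hχt⟩ := exists_monoidHom_ne_one_re_ge (fun j => π (t j)) (fun j => π (u j))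
    (fun j => by rw [← map_pow, hu, map_one]) hpq hT (by rw [← hW] at hTA; exact hTA)
  have hunit : ∀ b, Complex.normSq (χ b : ℂ) = 1 := by
    intro b
    have : ((χ b : ℂˣ) : ℂ) ^ Nat.card (Abelianization K ⧸ W) = 1 := by
      rw [← Units.val_pow_eq_pow_val, ← map_pow, pow_card_eq_one', map_one, Units.val_one]
    rw [Complex.normSq_eq_norm_sq, Complex.norm_eq_one_of_pow_eq_one this Nat.card_pos.ne', one_pow]
  obtain ⟨ψ, hψ⟩ := (χ.comp π).exists_equivariant ω (by
    intro g hg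
    have : π g = 1 := (QuotientGroup.eq_one_iff _).mpr ⟨g, hg, rfl⟩
    rw [MonoidHom.comp_apply, this, map_one])
  -- Dividing by `ψ ω` makes all values of the function values of `χ`, hence unimodular.
  refine ⟨fun x => ((ψ x / ψ ω : ℂˣ) : ℂ), ?_, ?_, ?_, ?_⟩
  · intro x
    obtain ⟨g, rfl⟩ := MulAction.exists_smul_eq K ω x
    beta_reduce
    rw [hψ, mul_div_cancel_right]
    exact hunit _
  · obtain ⟨k, hk⟩ : ∃ k, χ (π k) ≠ 1 := by
      by_contra! hall
      refine hχ (MonoidHom.ext fun b => ?_)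
      obtain ⟨k, rfl⟩ := hπ b
      exact hall k
    -- Translating by `k` permutes `Ω` but multiplies the sum by `χ (π k) ≠ 1`, so the sum vanishes.
    have hs : ∑ x, ((ψ x / ψ ω : ℂˣ) : ℂ) = (χ (π k) : ℂ) * ∑ x, ((ψ x / ψ ω : ℂˣ) : ℂ) := by
      rw [Finset.mul_sum]
      conv_lhs => rw [← Equiv.sum_comp (MulAction.toPerm k)]
      refine Finset.sum_congr rfl fun x _ => ?_
      rw [MulAction.toPerm_apply, hψ, mul_div_assoc, Units.val_mul]
      rfl
    have hk' : ((χ (π k) : ℂˣ) : ℂ) ≠ 1 := by simpa using hk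
    have : (((χ (π k) : ℂˣ) : ℂ) - 1) * ∑ x, ((ψ x / ψ ω : ℂˣ) : ℂ) = 0 := by
      rw [sub_mul, one_mul, ← hs, sub_self]
    exact (mul_eq_zero.mp this).resolve_left (sub_ne_zero.mpr hk')
  · intro j x
    beta_reduce
    rw [hψ]
    simp [hχu j]
  · intro j
    refine ⟨χ (π (t j)), hχt j, Units.ne_zero _, ?_, fun x => ?_⟩
    · rw [Complex.inv_re, hunit, div_one]
    · beta_reduce
      rw [hψ, mul_div_assoc, Units.val_mul]
      rfl

end TransitiveAction

/-! ### Generators extracted from a symmetric multiset. -/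

/-- A symmetric multiset splits into pairs of inverse elements and involutions. -/
theorem SymmetricMultiset.exists_decomposition {G : Type*} [Group G] {S : Multiset G}
    (hS : SymmetricMultiset S) :
    ∃ T U : Multiset G, S = T + T.map (fun g => g⁻¹) + U ∧ ∀ g ∈ U, g⁻¹ = g := by
  classical
  have hS' : ∀ g : G, S.count g⁻¹ = S.count g := fun g => by convert hS g
  clear hS
  induction S using Multiset.strongInductionOn with
  | ih S ih =>
    by_cases h : ∀ g ∈ S, g⁻¹ = g
    · exact ⟨0, S, by simp, h⟩
    push Not at h
    obtain ⟨g, hg, hne⟩ := h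
    obtain ⟨S₁, rfl⟩ := Multiset.exists_cons_of_mem hg
    have hg' : g⁻¹ ∈ S₁ := by
      have : g⁻¹ ∈ g ::ₘ S₁ := by
        rw [← Multiset.count_pos, hS' g, Multiset.count_pos]
        exact hg
      exact (Multiset.mem_cons.mp this).resolve_left hne
    obtain ⟨S₂, rfl⟩ := Multiset.exists_cons_of_mem hg'
    obtain ⟨T, U, hTU, hU⟩ := ih S₂
      ((Multiset.lt_cons_self _ _).trans (Multiset.lt_cons_self _ _)) (by
        intro x
        have := hS' x
        simp only [Multiset.count_cons, inv_eq_iff_eq_inv (a := x), inv_inv] at this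
        split_ifs at this <;> simp_all)
    exact ⟨g ::ₘ T, U, by simp [hTU, Multiset.cons_swap], hU⟩

/-- An inverse pair counts twice in `|S|` but is one generator; this is the source of the exponent
`2 * p + q`. -/
theorem SymmetricMultiset.exists_generators {G : Type*} [Group G] {S : Multiset G}
    (hS : SymmetricMultiset S) :
    ∃ (p q : ℕ) (t : Fin p → G) (u : Fin q → G), Multiset.card S = 2 * p + q ∧
      (∀ j, u j ^ 2 = 1) ∧
      ∀ s, s ∈ S ↔ (∃ j, s = t j) ∨ (∃ j, s = (t j)⁻¹) ∨ ∃ j, s = u j := by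
  obtain ⟨T, U, rfl, hU⟩ := hS.exists_decomposition
  obtain ⟨T, rfl⟩ : ∃ l : List G, (l : Multiset G) = T := Quot.exists_rep T
  obtain ⟨U, rfl⟩ : ∃ l : List G, (l : Multiset G) = U := Quot.exists_rep U
  refine ⟨T.length, U.length, T.get, U.get, ?_, fun j => ?_, fun s => ?_⟩
  · simp only [Multiset.card_add, Multiset.card_map, Multiset.coe_card]
    ring
  · have := hU (U.get j) (List.get_mem U j)
    rw [sq, ← eq_inv_iff_mul_eq_one, this]
  · have hmem : ∀ (L : List G) x, x ∈ L ↔ ∃ j, x = L.get j := fun L x => by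
      rw [List.mem_iff_get]; simp only [eq_comm]
    simp only [Multiset.mem_add, Multiset.mem_map, Multiset.mem_coe]
    rw [or_assoc, hmem T s, hmem U s]
    refine or_congr Iff.rfl (or_congr ⟨?_, ?_⟩ Iff.rfl)
    · rintro ⟨a, ha, rfl⟩
      obtain ⟨j, rfl⟩ := (hmem T a).mp ha
      exact ⟨j, rfl⟩
    · rintro ⟨j, rfl⟩
      exact ⟨_, List.get_mem T j, rfl⟩

/-! ### The exponent, and assembly of the two ranges of `T`. -/

theorem sub_one_mul_one_add_sum_pow (d : ℝ) {c : ℕ} (hc : 1 ≤ c) :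
    (d - 1) * (1 + ∑ n ∈ Finset.Ico 1 c, d ^ (n + 1)) = d ^ (c + 1) - d ^ 2 + d - 1 := by
  induction c, hc using Nat.le_induction with
  | base => simp
  | succ c hc ih =>
    rw [Finset.sum_Ico_succ_top hc, ← add_assoc, mul_add, ih]
    ring

theorem nilpotentGapExponent_eq {d c : ℕ} (hd : 2 ≤ d) (hc : 1 ≤ c) :
    nilpotentGapExponent d c =
      2 / (d * ((1 + ∑ n ∈ Finset.Ico 1 c, d ^ (n + 1) : ℕ) : ℝ)) := by
  have hd' : (2 : ℝ) ≤ d := by exact_mod_cast hd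
  have h1 : (d : ℝ) - 1 ≠ 0 := by linarith
  rw [nilpotentGapExponent, ← sub_one_mul_one_add_sum_pow (d : ℝ) hc]
  push_cast
  rw [mul_comm 2, mul_left_comm, mul_div_mul_left _ _ h1]

theorem zpow_le_nilpotentGapExponent {d c : ℕ} (hd : 2 ≤ d) (hc : 1 ≤ c) :
    (d : ℝ) ^ (-(c : ℤ) - 1) ≤ nilpotentGapExponent d c := by
  have hd' : (2 : ℝ) ≤ d := by exact_mod_cast hd
  have hz : (d : ℝ) ^ (-(c : ℤ) - 1) = 1 / (d : ℝ) ^ (c + 1) := by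
    rw [show (-(c : ℤ) - 1) = -((c + 1 : ℕ) : ℤ) by push_cast; ring, zpow_neg, zpow_natCast,
      one_div]
  have hpow : (d : ℝ) ^ 2 ≤ (d : ℝ) ^ (c + 1) := pow_le_pow_right₀ (by linarith) (by omega)
  have hD : 0 < (d : ℝ) ^ (c + 1) - (d : ℝ) ^ 2 + d - 1 := by linarith
  rw [hz, nilpotentGapExponent, div_le_div_iff₀ (by positivity) (by positivity), one_mul]
  have hP : 0 < (d : ℝ) ^ (c + 1) := by positivity
  -- With `P = d ^ (c + 1)`, the difference of the two sides is `(d - 2) P + d (d² - d + 1)`.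
  nlinarith [mul_nonneg (sub_nonneg.mpr hd') hP.le, mul_nonneg (sub_nonneg.mpr hd')
    (by nlinarith : (0 : ℝ) ≤ d ^ 2 - d + 1)]

/-- The spectral gap bound in the range where it follows from a pair of vertices of small
multiplicity. -/
theorem RegularMultigraph.gap_le_five_div {V : Type*} [Fintype V] [DecidableEq V] [Nontrivial V]
    {d : ℕ} (Γ : RegularMultigraph V d) (hd : 2 ≤ d) {T : ℝ} (hT1 : 1 ≤ T) (hT4 : T ≤ 4)
    (hTN : T ^ d ≤ (Fintype.card V : ℝ) ^ 2) : Γ.gap ≤ 5 / T := by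
  obtain ⟨x, y, hxy, hm⟩ := Γ.exists_ne_card_sub_one_mul_mult_le
  refine (Γ.gap_le_one_add_mult_div (by omega) hxy).trans ?_
  have hd0 : (0 : ℝ) < d := by positivity
  have hT0 : 0 < T := by linarith
  have hN : 2 ≤ Fintype.card V := Fintype.one_lt_card
  set N := Fintype.card V
  set m := Γ.mult x y
  have key : ∀ k : ℕ, 0 < k → k * m ≤ d → (m : ℝ) / d ≤ 1 / k := by
    intro k hk h
    have : (k : ℝ) * m ≤ d := by exact_mod_cast h
    rw [div_le_div_iff₀ hd0 (by positivity)]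
    linarith
  have hTN' : T ≤ N := by
    have : T ^ 2 ≤ (N : ℝ) ^ 2 := (pow_le_pow_right₀ hT1 hd).trans hTN
    exact (pow_le_pow_iff_left₀ hT0.le (by positivity) two_ne_zero).mp this
  rw [le_div_iff₀ hT0]
  -- It remains to see `T (1 + m / d) ≤ 5`, knowing `(N - 1) m ≤ d` and `T ≤ min 4 N`. For `N ≥ 5`
  -- this is `4 · 5/4`, with equality possible. Only `N = 4` needs more: `m = 0` if `d = 2`, and `T
  -- ^ 3 ≤ 16` if `d ≥ 3`.
  rcases Nat.lt_or_ge N 5 with h5 | h5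
  · obtain h | h | h : N = 2 ∨ N = 3 ∨ N = 4 := by omega
    · rw [h] at hm hTN'
      have := key 1 one_pos (by omega)
      push_cast at *
      nlinarith
    · rw [h] at hm hTN'
      have := key 2 two_pos (by omega)
      push_cast at *
      nlinarith
    · rw [h] at hm hTN hTN'
      rcases hd.eq_or_lt with h2 | h3
      · have hm0 : m = 0 := by omega
        rw [hm0, Nat.cast_zero, zero_div]
        linarith
      · have := key 3 three_pos (by omega)
        have hT3 : T ^ 3 ≤ 16 := by
          refine (pow_le_pow_right₀ hT1 h3).trans (hTN.trans ?_)
          norm_num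
        have : T ≤ 3 := by
          by_contra! hlt
          have := pow_lt_pow_left₀ hlt (by norm_num) three_ne_zero
          norm_num at this
          linarith
        push_cast at *
        nlinarith
  · have := key 4 four_pos (le_trans (Nat.mul_le_mul_right _ (by omega)) hm)
    push_cast at *
    nlinarith

/-- The spectral gap bound for nilpotent groups in the range covered by the pigeonhole principle for
characters. -/
theorem schreierGraph_gap_le_five_div {G : Type*} [Group G] [Group.IsNilpotent G] {c : ℕ}
    (hc : 1 ≤ c) (hclass : Group.nilpotencyClass G ≤ c)
    {Ω : Type*} [Fintype Ω] [DecidableEq Ω] [Nontrivial Ω] [MulAction G Ω]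
    (S : Multiset G) (hS : SymmetricMultiset S) (hcard : 2 ≤ Multiset.card S) {T : ℝ} (hT : 4 < T)
    (hTA : ∀ A : ℕ, Fintype.card Ω ≤
      A ^ (1 + ∑ n ∈ Finset.Ico 1 c, (Multiset.card S) ^ (n + 1)) →
      T ^ Multiset.card S ≤ (A : ℝ) ^ 2) :
    (schreierGraph Ω S hS).gap ≤ 5 / T := by
  classical
  obtain ⟨p, q, t, u, hpq, hu, hmem⟩ := hS.exists_generators
  let s : Fin (p + q) → G := Fin.append t u
  let K : Subgroup G := Subgroup.closure (Set.range s)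
  have htK : ∀ j, t j ∈ K := fun j =>
    Subgroup.subset_closure ⟨Fin.castAdd q j, Fin.append_left t u j⟩
  have huK : ∀ j, u j ∈ K := fun j =>
    Subgroup.subset_closure ⟨Fin.natAdd p j, Fin.append_right t u j⟩
  have hSK : ∀ g ∈ S, g ∈ K := by
    intro g hg
    rcases (hmem g).mp hg with ⟨j, rfl⟩ | ⟨j, rfl⟩ | ⟨j, rfl⟩
    exacts [htK j, inv_mem (htK j), huK j]
  by_cases htrans : ∀ x y : Ω, ∃ k : K, k • x = y
  swap
  · push Not at htrans
    obtain ⟨x, y, hxy⟩ := htrans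
    refine (schreierGraph_gap_nonpos S hS (by omega)
      (Finset.univ.filter fun z => ∃ k : K, k • x = z) ⟨x, by simpa using ⟨1, one_mem K, by simp⟩⟩
      ⟨y, by simpa using hxy⟩ ?_).trans (by positivity)
    intro g hg z
    simp only [Finset.mem_filter, Finset.mem_univ, true_and]
    constructor
    · rintro ⟨k, hk⟩
      refine ⟨⟨g, hSK g hg⟩⁻¹ * k, ?_⟩
      rw [mul_smul, hk, inv_smul_eq_iff]
      rfl
    · rintro ⟨k, rfl⟩
      exact ⟨⟨g, hSK g hg⟩ * k, mul_smul _ _ _⟩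
  have : MulAction.IsPretransitive K Ω := ⟨htrans⟩
  obtain ⟨ω⟩ : Nonempty Ω := inferInstance
  let s' : Fin (p + q) → K := fun i => ⟨s i, Subgroup.subset_closure ⟨i, rfl⟩⟩
  have hs' : Subgroup.closure (Set.range s') = ⊤ := by
    rw [← Subgroup.closure_closure_coe_preimage (k := Set.range s)]
    congr 1
    ext k
    simp [s', Subtype.ext_iff]
  have hindex : (MulAction.stabilizer K ω).index = Fintype.card Ω := by
    rw [MulAction.index_stabilizer_of_transitive, Nat.card_eq_fintype_card]
  have hN := Subgroup.index_le_index_sup_commutator_pow (d := Multiset.card S) hc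
    (Subgroup.lowerCentralSeries_eq_bot_iff_nilpotencyClass_le.mpr
      ((Subgroup.nilpotencyClass_le K).trans hclass)) s' hs' (by
        -- One inverse pair already gives `p + q < 2 * p + q`; with none, all generators are
        -- involutions.
        rcases Nat.eq_zero_or_pos p with rfl | hp
        · refine Or.inr ⟨by omega, fun i => Subtype.ext ?_⟩
          change s i ^ 2 = 1
          refine Fin.addCases (fun j => j.elim0) (fun j => ?_) i
          exact (congrArg (· ^ 2) (Fin.append_right t u j)).trans (hu j)
        · left; omega)
    (MulAction.stabilizer K ω) (by rw [hindex]; exact Fintype.one_lt_card)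
  rw [hindex] at hN
  have hTA' := hTA _ hN
  rw [hpq] at hTA'
  obtain ⟨ψ, hψ1, hψ0, hψu, hψt⟩ := exists_almost_invariant_eigenfunction ω
    (fun j => (⟨t j, htK j⟩ : K)) (fun j => (⟨u j, huK j⟩ : K)) (fun j => Subtype.ext (hu j))
    (by omega) hT hTA'
  refine schreierGraph_gap_le_of_eigenfunction S hS (by omega) ψ hψ1 hψ0 _ fun g hg => ?_
  rcases (hmem g).mp hg with ⟨j, rfl⟩ | ⟨j, rfl⟩ | ⟨j, rfl⟩
  · obtain ⟨z, hz, -, -, h⟩ := hψt j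
    exact ⟨z, hz, h⟩
  · obtain ⟨z, hz, hz0, hzinv, h⟩ := hψt j
    refine ⟨z⁻¹, by rwa [hzinv], fun x => ?_⟩
    have := h ((t j)⁻¹ • x)
    rw [show (⟨t j, htK j⟩ : K) • (t j)⁻¹ • x = x from smul_inv_smul (t j) x] at this
    rw [this, inv_mul_cancel_left₀ hz0]
  · refine ⟨1, ?_, fun x => ?_⟩
    · have : 0 < 5 / T := by positivity
      rw [Complex.one_re]; linarith
    · rw [one_mul]; exact hψu j x

theorem theorem3 {G : Type*} [Group G] [Group.IsNilpotent G] (c : ℕ) (hc : 1 ≤ c)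
    (hclass : Group.nilpotencyClass G = c)
    {Ω : Type*} [Fintype Ω] [DecidableEq Ω] [Nontrivial Ω]
    [MulAction G Ω] [MulAction.IsPretransitive G Ω]
    (S : Multiset G) (hS : SymmetricMultiset S) (hcard : 2 ≤ Multiset.card S) :
    (schreierGraph Ω S hS).gap ≤
        5 * (Fintype.card Ω : ℝ) ^ (-nilpotentGapExponent (Multiset.card S) c) ∧
      ((Multiset.card S : ℝ) ^ (-(c : ℤ) - 1)) ≤ nilpotentGapExponent (Multiset.card S) c := by
  refine ⟨?_, zpow_le_nilpotentGapExponent hcard hc⟩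
  have hf := nilpotentGapExponent_eq hcard hc
  set d := Multiset.card S with hd
  set E : ℕ := 1 + ∑ n ∈ Finset.Ico 1 c, d ^ (n + 1) with hE
  set f := nilpotentGapExponent d c
  have hd0 : (0 : ℝ) < d := by positivity
  have hE1 : (1 : ℝ) ≤ E := by exact_mod_cast (show 1 ≤ E by omega)
  have hN2 : 2 ≤ Fintype.card Ω := Fintype.one_lt_card
  set N := Fintype.card Ω with hN
  have hN1 : (1 : ℝ) ≤ N := by exact_mod_cast (show 1 ≤ N by omega)
  have hf0 : 0 < f := by rw [hf]; positivity
  rw [Real.rpow_neg (by positivity), ← div_eq_mul_inv]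
  have hT1 : 1 ≤ (N : ℝ) ^ f := Real.one_le_rpow hN1 hf0.le
  have hTd : ((N : ℝ) ^ f) ^ d = (N : ℝ) ^ (2 / E : ℝ) := by
    rw [← Real.rpow_natCast, ← Real.rpow_mul (by positivity), hf]
    congr 1
    field_simp
  have hTA : ∀ A : ℕ, N ≤ A ^ E → ((N : ℝ) ^ f) ^ d ≤ (A : ℝ) ^ 2 := by
    intro A hA
    have hA' : (N : ℝ) ≤ (A : ℝ) ^ E := by exact_mod_cast hA
    rw [hTd]
    calc (N : ℝ) ^ (2 / E : ℝ) ≤ ((A : ℝ) ^ E) ^ (2 / E : ℝ) := by gcongr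
      _ = (A : ℝ) ^ 2 := by
        rw [← Real.rpow_natCast, ← Real.rpow_mul (by positivity), mul_div_cancel₀ _ (by positivity)]
        norm_cast
  -- For small `T`, the hypothesis `T ^ d ≤ N ^ 2` is the case `A = N` of `hTA`.
  rcases le_or_gt ((N : ℝ) ^ f) 4 with h4 | h4
  · exact RegularMultigraph.gap_le_five_div _ hcard hT1 h4
      (hTA N (Nat.le_self_pow (by omega) N))
  · exact schreierGraph_gap_le_five_div hc hclass.le S hS hcard h4 hTA
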